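/- Let $X$ be an infinite set whose elements are regarded as individuals (i.e. $\emptyset\notin X$ and no element of $X$ has an element in $\mathbb{V}(X)$), where $\mathbb{V}(X)=\bigcup_{n\in\mathbb{N}}V_n(X)$, $V_0(X)=X$, $V_{n+1}(X)=V_n(X)\cup\wp(V_n(X))$, is the superstructure over $X$. Let $\ast:\mathbb{V}(X)\to\mathbb{V}(X)$ satisfy the transfer principle: for every formula $\varphi(x_1,\dots,x_k)$ with bounded quantifiers in the language of $\in$ and $=$, and all $a_1,\dots,a_k\in\mathbb{V}(X)$, $\varphi(a_1,\dots,a_k)$ holds in $\mathbb{V}(X)$ if and only if $\varphi({}^\ast a_1,\dots,{}^\ast a_k)$ does. Put $S_0=\mathrm{id}$ and $S_{n+1}=\ast\circ S_n$. Let $(S,\cdot)\in\mathbb{V}(X)$ be a semigroup whose underlying set $S$ is completely coherent, i.e. $A\subseteq{}^\ast A$ for every $A\subseteq S$. For an ultrafilter $\mathcal{W}$ on $S$ and $n\in\mathbb{N}=\{0,1,2,\dots\}$ let $\mu_n(\mathcal{W})=\bigcap_{A\in\mathcal{W}}S_n(A)$, and call the elements of $\mu_\infty(\mathcal{W})=\bigcap_{A\in\mathcal{W}}\bigcup_{k\in\mathbb{N}}S_k(A)$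 the generators of $\mathcal{W}$. For ultrafilters $\mathcal{U},\mathcal{V}$ on $S$ let $\mathcal{U}\odot\mathcal{V}$ be the ultrafilter on $S$ with $$A\in\mathcal{U}\odot\mathcal{V}\iff\{s\in S\mid\{t\in S\mid s\cdot t\in A\}\in\mathcal{V}\}\in\mathcal{U}.$$ Let $\mathcal{U},\mathcal{V}$ be ultrafilters on $S$, let $n,m\in\mathbb{N}$, $\alpha\in\mu_n(\mathcal{U})$ and $\beta\in\mu_m(\mathcal{V})$. Then the product $\alpha\cdot S_n(\beta)$, computed with the extended operation $S_{n+m}(\cdot)$, is well defined (there is exactly one $\gamma\in\mathbb{V}(X)$ with $((\alpha,S_n(\beta)),\gamma)\in S_{n+m}(\cdot)$), and $$\alpha\cdot S_n(\beta)\in\mu_{n+m}(\mathcal{U}\odot\mathcal{V}).$$ In particular, $\alpha\cdot S_n(\beta)$ is a generator of $\mathcal{U}\odot\mathcal{V}$. -/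

import Mathlib

universe u

namespace IteratedHyper

/-! ### Superstructures -/

/-- The levels of the superstructure over `X`: `V₀(X) = X`, `Vₙ₊₁(X) = Vₙ(X) ∪ ℘(Vₙ(X))`. -/
noncomputable def level (X : ZFSet.{u}) : ℕ → ZFSet.{u}
  | 0 => X
  | n + 1 => level X n ∪ (level X n).powerset

/-- The elements of `X` can serve as individuals (atoms) of the superstructure: none of them is
the empty set, and none of them has an element lying in `𝕍(X)`. -/
def IsBaseSet (X : ZFSet.{u}) : Prop :=
  ∅ ∉ X ∧ ∀ x ∈ X, ∀ n, ∀ y ∈ level X n, y ∉ x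

/-- The superstructure `𝕍(X) = ⋃ₙ Vₙ(X)`. -/
def Superstructure (X : ZFSet.{u}) : Type (u + 1) :=
  {x : ZFSet.{u} // ∃ n, x ∈ level X n}

instance (X : ZFSet.{u}) : Membership (Superstructure X) (Superstructure X) :=
  ⟨fun b a => a.1 ∈ b.1⟩

variable {X : ZFSet.{u}}

/-- An element of `𝕍(X)` is a set of the superstructure if it is not an individual. -/
def Superstructure.IsSet (a : Superstructure X) : Prop := a.1 ∉ X

/-- The type of elements of `S ∈ 𝕍(X)`. -/
def Elem (S : Superstructure X) : Type (u + 1) := {a : Superstructure X // a ∈ S}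

theorem subset_level_of_isSet {S : Superstructure X} (hS : S.IsSet) :
    ∃ n, ∀ x ∈ S.1, x ∈ level X n := by
  obtain ⟨n, hn⟩ := S.2
  induction n with
  | zero => exact absurd hn hS
  | succ n ih =>
    simp only [level, ZFSet.mem_union, ZFSet.mem_powerset] at hn
    rcases hn with h | h
    · exact ih h
    · exact ⟨n, fun x hx => h hx⟩

theorem mem_level_succ_of_subset {n : ℕ} {a : ZFSet.{u}} (h : ∀ x ∈ a, x ∈ level X n) :
    a ∈ level X (n + 1) := by
  simp only [level, ZFSet.mem_union, ZFSet.mem_powerset]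
  exact Or.inr fun x hx => h x hx

theorem mem_level_succ {n : ℕ} {a : ZFSet.{u}} (h : a ∈ level X n) : a ∈ level X (n + 1) := by
  simp only [level, ZFSet.mem_union]
  exact Or.inl h

theorem pair_mem_level {n : ℕ} {a b : ZFSet.{u}} (ha : a ∈ level X n) (hb : b ∈ level X n) :
    ZFSet.pair a b ∈ level X (n + 2) := by
  apply mem_level_succ_of_subset
  intro x hx
  apply mem_level_succ_of_subset
  intro y hy
  simp only [ZFSet.pair, ZFSet.mem_pair] at hx
  rcases hx with rfl | rfl
  · rw [ZFSet.mem_singleton] at hy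
    exact hy ▸ ha
  · rw [ZFSet.mem_pair] at hy
    rcases hy with rfl | rfl <;> assumption

/-- A collection `A` of elements of `S`, as an element of `𝕍(X)`. -/
noncomputable def ofSet (S : Superstructure X) (hS : S.IsSet) (A : Set (Elem S)) :
    Superstructure X :=
  ⟨S.1.sep fun z => ∃ a ∈ A, a.1.1 = z, by
    obtain ⟨n, hn⟩ := subset_level_of_isSet hS
    exact ⟨n + 1, mem_level_succ_of_subset fun x hx => hn x (ZFSet.mem_sep.1 hx).1⟩⟩

/-- A binary operation on `S` as an element of `𝕍(X)`: the set of all `((a, b), a * b)` with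
`a, b ∈ S`, where pairs are Kuratowski pairs. -/
noncomputable def mulGraph (S : Superstructure X) (hS : S.IsSet) [Mul (Elem S)] :
    Superstructure X :=
  ⟨((S.1.prod S.1).prod S.1).sep fun z =>
      ∃ a b : Elem S, z = ZFSet.pair (ZFSet.pair a.1.1 b.1.1) (a * b).1.1, by
    obtain ⟨n, hn⟩ := subset_level_of_isSet hS
    refine ⟨n + 5, mem_level_succ_of_subset fun x hx => ?_⟩
    obtain ⟨a, b, rfl⟩ := (ZFSet.mem_sep.1 hx).2
    exact pair_mem_level (pair_mem_level (hn _ a.2) (hn _ b.2))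
      (mem_level_succ (mem_level_succ (hn _ (a * b).2)))⟩

/-! ### Transfer and star maps -/

/-- First order formulas with bounded quantifiers in the language of `∈` and `=`, with variables
`x₀, x₁, x₂, …`. The other connectives and the bounded existential quantifier are expressed
through negation, conjunction and the bounded universal quantifier. -/
inductive BoundedFormula : Type
  | eq (i j : ℕ) : BoundedFormula
  | mem (i j : ℕ) : BoundedFormula
  | neg (φ : BoundedFormula) : BoundedFormula
  | and (φ ψ : BoundedFormula) : BoundedFormula
  /-- `∀ xᵢ ∈ xⱼ, φ` -/
  | ball (i j : ℕ) (φ : BoundedFormula) : BoundedFormula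

/-- Truth in `𝕍(X)` of a bounded quantifier formula under an assignment of the variables. -/
def BoundedFormula.Holds : BoundedFormula → (ℕ → Superstructure X) → Prop
  | .eq i j, v => v i = v j
  | .mem i j, v => v i ∈ v j
  | .neg φ, v => ¬ φ.Holds v
  | .and φ ψ, v => φ.Holds v ∧ ψ.Holds v
  | .ball i j φ, v => ∀ y : Superstructure X, y ∈ v j → φ.Holds (Function.update v i y)

/-- `⟨𝕍(X), 𝕍(X), ∗⟩` is a single superstructure model of nonstandard methods: `X` is an infinite
(base) set and `∗ : 𝕍(X) → 𝕍(X)` satisfies the transfer principle. -/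
structure IsSingleSuperstructureModel (X : ZFSet.{u})
    (star : Superstructure X → Superstructure X) : Prop where
  isBaseSet : IsBaseSet X
  infinite : {x : ZFSet.{u} | x ∈ X}.Infinite
  transfer : ∀ (φ : BoundedFormula) (v : ℕ → Superstructure X),
    φ.Holds v ↔ φ.Holds fun i => star (v i)

/-- The iterated star map `Sₙ`: `S₀ = id` and `Sₙ₊₁ = ∗ ∘ Sₙ`. -/
def iterStar (star : Superstructure X → Superstructure X) :
    ℕ → Superstructure X → Superstructure X
  | 0 => id
  | n + 1 => star ∘ iterStar star n

/-- `Y` is completely coherent: every `A ⊆ Y` is coherent, that is, `A ⊆ ∗A`. -/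
def CompletelyCoherent (star : Superstructure X → Superstructure X)
    (Y : Superstructure X) (hY : Y.IsSet) : Prop :=
  ∀ A : Set (Elem Y), ∀ a : Superstructure X, a ∈ ofSet Y hY A → a ∈ star (ofSet Y hY A)

/-! ### Monads -/

/-- `μₙ(𝓤) = ⋂_{A ∈ 𝓤} Sₙ(A)` for an ultrafilter `𝓤` on `Y`. -/
def monad (star : Superstructure X → Superstructure X) {Y : Superstructure X} (hY : Y.IsSet)
    (n : ℕ) (𝓤 : Ultrafilter (Elem Y)) : Set (Superstructure X) :=
  {α | ∀ A ∈ 𝓤, α ∈ iterStar star n (ofSet Y hY A)}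

/-- The set of generators `μ_∞(𝓤) = ⋂_{A ∈ 𝓤} ⋃ₙ Sₙ(A)` of an ultrafilter `𝓤` on `Y`. -/
def generators (star : Superstructure X → Superstructure X) {Y : Superstructure X}
    (hY : Y.IsSet) (𝓤 : Ultrafilter (Elem Y)) : Set (Superstructure X) :=
  {α | ∀ A ∈ 𝓤, ∃ n, α ∈ iterStar star n (ofSet Y hY A)}

/-! ### Products of ultrafilters -/

/-- The tensor product of two ultrafilters. -/
def tensor {S T : Type*} (𝓤 : Ultrafilter S) (𝓥 : Ultrafilter T) : Ultrafilter (S × T) :=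
  𝓤.bind fun s => 𝓥.map fun t => (s, t)

theorem mem_tensor {S T : Type*} (𝓤 : Ultrafilter S) (𝓥 : Ultrafilter T) (A : Set (S × T)) :
    A ∈ tensor 𝓤 𝓥 ↔ {s | {t | (s, t) ∈ A} ∈ 𝓥} ∈ 𝓤 := Iff.rfl

/-- `𝓤 ⊙ 𝓥`: the image of the tensor product under the multiplication. -/
def odot {S : Type*} [Mul S] (𝓤 𝓥 : Ultrafilter S) : Ultrafilter S :=
  (tensor 𝓤 𝓥).map fun p => p.1 * p.2

theorem mem_odot {S : Type*} [Mul S] (𝓤 𝓥 : Ultrafilter S) (A : Set S) :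
    A ∈ odot 𝓤 𝓥 ↔ {s | {t | s * t ∈ A} ∈ 𝓥} ∈ 𝓤 := Iff.rfl

/-- `γ` is a value of the extended operation `Sₖ(·)` at `(α, β)`, i.e. `((α, β), γ) ∈ Sₖ(·)`. -/
def IsHyperProduct (star : Superstructure X → Superstructure X) {S : Superstructure X}
    (hS : S.IsSet) [Mul (Elem S)] (k : ℕ) (α β γ : Superstructure X) : Prop :=
  ZFSet.pair (ZFSet.pair α.1 β.1) γ.1 ∈ (iterStar star k (mulGraph S hS)).1

end IteratedHyper

namespace IteratedHyper

variable {X : ZFSet.{u}} {star : Superstructure X → Superstructure X}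

/-! Let `A ∈ odot 𝓤 𝓥` and let `B` be the set of `s` with `{t | s * t ∈ A} ∈ 𝓥`, so `B ∈ 𝓤`. For `s
∈ B`, transfer along `Sₘ` puts a product of `s` and `β` in `Sₘ(A)`; complete coherence enters
through `Sₘ(s) = s`. Transferring this statement about all `s ∈ B` along `Sₙ`, with `β` as
parameter, puts a product of `α` and `Sₙ(β)` in `Sₙ₊ₘ(A)` (`exists_memGraph_of_mem_monad`).
Functionality of the graph also transfers (`eq_of_memGraph`), so the product does not depend on `A`.
-/

theorem Superstructure.ext {a b : Superstructure X} (h : a.1 = b.1) : a = b := Subtype.ext h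

theorem level_mono : Monotone fun n => {a | a ∈ level X n} :=
  monotone_nat_of_le_succ fun _ _ => mem_level_succ

theorem Superstructure.exists_level (a b : Superstructure X) :
    ∃ n, a.1 ∈ level X n ∧ b.1 ∈ level X n := by
  obtain ⟨n, hn⟩ := a.2
  obtain ⟨m, hm⟩ := b.2
  exact ⟨max n m, level_mono (le_max_left n m) hn, level_mono (le_max_right n m) hm⟩

/-- The ordered pair of two elements of the superstructure. -/
noncomputable def pair (a b : Superstructure X) : Superstructure X :=
  ⟨ZFSet.pair a.1 b.1, by
    obtain ⟨n, ha, hb⟩ := a.exists_level b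
    exact ⟨n + 2, pair_mem_level ha hb⟩⟩

/-- The unordered pair of two elements of the superstructure. -/
noncomputable def upair (a b : Superstructure X) : Superstructure X :=
  ⟨{a.1, b.1}, by
    obtain ⟨n, ha, hb⟩ := a.exists_level b
    refine ⟨n + 1, mem_level_succ_of_subset fun x hx => ?_⟩
    rw [ZFSet.mem_pair] at hx
    rcases hx with rfl | rfl <;> assumption⟩

theorem left_mem_upair (a b : Superstructure X) : a ∈ upair a b := ZFSet.mem_pair.2 (.inl rfl)

theorem right_mem_upair (a b : Superstructure X) : b ∈ upair a b := ZFSet.mem_pair.2 (.inr rfl)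

theorem upair_mem_pair (a b : Superstructure X) : upair a b ∈ pair a b :=
  ZFSet.mem_pair.2 (.inr rfl)

/-- The singleton of an element of the superstructure. -/
noncomputable def single (a : Superstructure X) : Superstructure X :=
  ⟨{a.1}, by
    obtain ⟨n, hn⟩ := a.2
    exact ⟨n + 1, mem_level_succ_of_subset fun x hx => by
      rw [ZFSet.mem_singleton] at hx
      exact hx ▸ hn⟩⟩

theorem mem_single {a b : Superstructure X} : a ∈ single b ↔ a = b :=
  ZFSet.mem_singleton.trans ⟨Superstructure.ext, congrArg _⟩

/-- Bounded quantifiers only see elements lying in `𝕍(X)`. An individual may have others, a set may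
not; this lemma and the next give extensionality where it is needed. -/
theorem IsBaseSet.isSet_of_mem (hX : IsBaseSet X) {y z : Superstructure X} (h : y ∈ z) :
    z.IsSet := fun hz => by
  obtain ⟨n, hn⟩ := y.2
  exact hX.2 _ hz n _ hn h

theorem Superstructure.IsSet.exists_of_mem {z : Superstructure X} (hz : z.IsSet) {x : ZFSet.{u}}
    (hx : x ∈ z.1) : ∃ x' : Superstructure X, x' ∈ z ∧ x'.1 = x := by
  obtain ⟨n, hn⟩ := subset_level_of_isSet hz
  exact ⟨⟨x, n, hn x hx⟩, hx, rfl⟩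

theorem mem_ofSet {S : Superstructure X} {hS : S.IsSet} {A : Set (Elem S)}
    {a : Superstructure X} : a ∈ ofSet S hS A ↔ ∃ x ∈ A, x.1 = a := by
  refine (ZFSet.mem_sep (p := fun z => ∃ a ∈ A, a.1.1 = z)).trans ⟨?_, ?_⟩
  · rintro ⟨-, x, hx, h⟩
    exact ⟨x, hx, Superstructure.ext h⟩
  · rintro ⟨x, hx, rfl⟩
    exact ⟨x.2, x, hx, rfl⟩

/-- `((a, b), c)` is an element of `G`. -/
def MemGraph (G a b c : Superstructure X) : Prop :=
  pair (pair a b) c ∈ G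

theorem memGraph_mulGraph {S : Superstructure X} {hS : S.IsSet} [Mul (Elem S)] (a b : Elem S) :
    MemGraph (mulGraph S hS) a.1 b.1 (a * b).1 := by
  refine (ZFSet.mem_sep (p := fun z => ∃ a b : Elem S, z =
    ZFSet.pair (ZFSet.pair a.1.1 b.1.1) (a * b).1.1)).2 ⟨?_, a, b, rfl⟩
  exact ZFSet.pair_mem_prod.2 ⟨ZFSet.pair_mem_prod.2 ⟨a.2, b.2⟩, (a * b).2⟩

theorem eq_of_pair_mem_mulGraph {S : Superstructure X} {hS : S.IsSet} [Mul (Elem S)]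
    {q c d : Superstructure X} (hc : pair q c ∈ mulGraph S hS)
    (hd : pair q d ∈ mulGraph S hS) : c = d := by
  have key {c : Superstructure X} (hc : pair q c ∈ mulGraph S hS) : ∃ a b : Elem S,
      ZFSet.pair q.1 c.1 = ZFSet.pair (ZFSet.pair a.1.1 b.1.1) (a * b).1.1 :=
    (ZFSet.mem_sep (p := fun z => ∃ a b : Elem S, z =
      ZFSet.pair (ZFSet.pair a.1.1 b.1.1) (a * b).1.1)).1 hc |>.2
  obtain ⟨a, b, h⟩ := key hc
  obtain ⟨a', b', h'⟩ := key hd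
  rw [ZFSet.pair_inj] at h h'
  obtain ⟨ha, hb⟩ := ZFSet.pair_inj.1 (h.1.symm.trans h'.1)
  obtain rfl : a = a' := Subtype.ext (Superstructure.ext ha)
  obtain rfl : b = b' := Subtype.ext (Superstructure.ext hb)
  exact Superstructure.ext (h.2.trans h'.2.symm)

/-! ### Bounded formulas for Kuratowski pairs -/

namespace BoundedFormula

/-- `∃ xᵢ ∈ xⱼ, φ` -/
def bex (i j : ℕ) (φ : BoundedFormula) : BoundedFormula := neg (ball i j (neg φ))

theorem holds_bex {i j : ℕ} {φ : BoundedFormula} {v : ℕ → Superstructure X} :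
    (bex i j φ).Holds v ↔ ∃ y, y ∈ v j ∧ φ.Holds (Function.update v i y) := by
  simp [bex, Holds]

/-- `x_z = {x_a, x_b}`, with the auxiliary variable `x₁₂`. -/
def isUPair (z a b : ℕ) : BoundedFormula :=
  and (and (mem a z) (mem b z)) (ball 12 z (neg (and (neg (eq 12 a)) (neg (eq 12 b)))))

theorem holds_isUPair (hX : IsBaseSet X) {z a b : ℕ} (ha : a ≠ 12) (hb : b ≠ 12)
    {v : ℕ → Superstructure X} :
    (isUPair z a b).Holds v ↔ (v z).1 = {(v a).1, (v b).1} := by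
  simp only [isUPair, Holds, Function.update_self, Function.update_of_ne ha,
    Function.update_of_ne hb]
  constructor
  · rintro ⟨⟨h1, h2⟩, h3⟩
    ext x
    rw [ZFSet.mem_pair]
    constructor
    · intro hx
      obtain ⟨x, hx', rfl⟩ := (hX.isSet_of_mem h1).exists_of_mem hx
      have := h3 x hx'
      rw [not_and_or, not_not, not_not] at this
      exact this.imp (congrArg _) (congrArg _)
    · rintro (rfl | rfl)
      exacts [h1, h2]
  · intro h
    have key (x : Superstructure X) : x ∈ v z ↔ x = v a ∨ x = v b := by
      change x.1 ∈ (v z).1 ↔ _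
      rw [h, ZFSet.mem_pair]
      exact or_congr ⟨Superstructure.ext, congrArg _⟩ ⟨Superstructure.ext, congrArg _⟩
    refine ⟨⟨(key _).2 (.inl rfl), (key _).2 (.inr rfl)⟩, fun y hy => ?_⟩
    rw [not_and_or, not_not, not_not]
    exact (key y).1 hy

/-- `x_z = (x_a, x_b)`, with the auxiliary variables `x₁₀, x₁₁, x₁₂`. -/
def isPair (z a b : ℕ) : BoundedFormula :=
  bex 10 z (bex 11 z (and (isUPair 10 a a) (and (isUPair 11 a b) (isUPair z 10 11))))

theorem holds_isPair (hX : IsBaseSet X) {z a b : ℕ} (hz : z < 10) (ha : a < 10) (hb : b < 10)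
    {v : ℕ → Superstructure X} :
    (isPair z a b).Holds v ↔ (v z).1 = ZFSet.pair (v a).1 (v b).1 := by
  -- `ZFSet.pair` has a singleton where the formula has `{x, x}`.
  have hs (x : ZFSet.{u}) : ({x, x} : ZFSet.{u}) = {x} := by ext; simp
  simp only [isPair, holds_bex, Holds,
    holds_isUPair hX (show a ≠ 12 by omega) (show a ≠ 12 by omega),
    holds_isUPair hX (show a ≠ 12 by omega) (show b ≠ 12 by omega),
    holds_isUPair hX (show 10 ≠ 12 by omega) (show 11 ≠ 12 by omega), Function.update_self,
    Function.update_of_ne (show 10 ≠ 11 by omega),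
    Function.update_of_ne (show z ≠ 10 by omega), Function.update_of_ne (show a ≠ 10 by omega),
    Function.update_of_ne (show b ≠ 10 by omega), Function.update_of_ne (show z ≠ 11 by omega),
    Function.update_of_ne (show a ≠ 11 by omega), Function.update_of_ne (show b ≠ 11 by omega),
    ZFSet.pair, hs]
  constructor
  · rintro ⟨p, -, q, -, hp, hq, h⟩
    rw [h, hp, hq]
  · intro h
    have hp : single (v a) ∈ v z := by
      change _ ∈ (v z).1
      rw [h]
      exact ZFSet.mem_pair.2 (.inl rfl)
    have hq : upair (v a) (v b) ∈ v z := by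
      change _ ∈ (v z).1
      rw [h]
      exact ZFSet.mem_pair.2 (.inr rfl)
    exact ⟨_, hp, _, hq, rfl, rfl, h⟩

end BoundedFormula

/-- An assignment of the first four variables. -/
def assign (a b c d : Superstructure X) : ℕ → Superstructure X
  | 0 => a
  | 1 => b
  | 2 => c
  | _ => d

/-! ### Consequences of transfer -/

namespace IsSingleSuperstructureModel

/-- Since each `Sₖ` is again a star map, the lemmas below apply to `Sₖ` in place of `star`. -/
theorem iterStar (h : IsSingleSuperstructureModel X star) (k : ℕ) :
    IsSingleSuperstructureModel X (iterStar star k) := by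
  refine ⟨h.isBaseSet, h.infinite, fun φ v => ?_⟩
  induction k with
  | zero => exact Iff.rfl
  | succ k ih => exact ih.trans (h.transfer φ _)

theorem mem_iff (h : IsSingleSuperstructureModel X star) {a b : Superstructure X} :
    a ∈ b ↔ star a ∈ star b :=
  h.transfer (.mem 0 1) (assign a b b b)

theorem mem_star_single (h : IsSingleSuperstructureModel X star) {a b : Superstructure X}
    (hb : b ∈ star (single a)) : b = star a := by
  have key := (h.transfer (.ball 2 0 (.eq 2 1)) (assign (single a) a a a)).1
  simp only [BoundedFormula.Holds, Function.update_self, Function.update_of_ne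
    (show 1 ≠ 2 by omega)] at key
  exact key (fun y hy => mem_single.1 hy) b hb

theorem exists_memGraph (h : IsSingleSuperstructureModel X star) {G B C A : Superstructure X}
    (H : ∀ s ∈ B, ∀ t ∈ C, ∃ c ∈ A, MemGraph G s t c) :
    ∀ s ∈ star B, ∀ t ∈ star C, ∃ c ∈ star A, MemGraph (star G) s t c := by
  have hX := h.isBaseSet
  -- The pair `q = (s, t)` is reached by bounded quantifiers as `q ∈ u ∈ p ∈ G`, where `p = (q, c)`
  -- and `u = {q, c}`; `p`, `u`, `q` are variables 7, 8, 9.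
  have key := h.transfer (.ball 4 1 (.ball 5 2 (.bex 6 3 (.bex 7 0 (.bex 8 7 (.bex 9 8
    (.and (.isPair 9 4 5) (.isPair 7 9 6))))))))
  simp only [BoundedFormula.Holds, BoundedFormula.holds_bex,
    BoundedFormula.holds_isPair hX (show 9 < 10 by omega) (show 4 < 10 by omega)
      (show 5 < 10 by omega),
    BoundedFormula.holds_isPair hX (show 7 < 10 by omega) (show 9 < 10 by omega)
      (show 6 < 10 by omega)] at key
  replace key := (key (assign G B C A)).1
  simp only [assign, ne_eq, Nat.reduceEqDiff, not_false_eq_true, Function.update_of_ne,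
    OfNat.zero_ne_ofNat, Function.update_self] at key
  have conv (G s t c : Superstructure X) : MemGraph G s t c ↔
      ∃ p ∈ G, ∃ u ∈ p, ∃ q ∈ u, q.1 = ZFSet.pair s.1 t.1 ∧ p.1 = ZFSet.pair q.1 c.1 := by
    constructor
    · exact fun hG => ⟨_, hG, _, upair_mem_pair _ _, _, left_mem_upair _ _, rfl, rfl⟩
    · rintro ⟨p, hp, u, -, q, -, hq, hp'⟩
      obtain rfl : q = pair s t := Superstructure.ext hq
      obtain rfl : p = pair (pair s t) c := Superstructure.ext hp'
      exact hp
  simp only [conv] at H ⊢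
  exact key H

theorem eq_of_memGraph (h : IsSingleSuperstructureModel X star) {G : Superstructure X}
    (H : ∀ q c d : Superstructure X, pair q c ∈ G → pair q d ∈ G → c = d)
    {a b c d : Superstructure X} (hc : MemGraph (star G) a b c) (hd : MemGraph (star G) a b d) :
    c = d := by
  have hX := h.isBaseSet
  -- Variables 1 and 2 are two elements of `G`, 3 and 4 range over their elements, and 5, 6, 7 stand
  -- for `q`, `c`, `d`.
  have key := h.transfer (.ball 1 0 (.ball 2 0 (.ball 3 1 (.ball 4 2 (.ball 5 3 (.ball 6 3
    (.ball 7 4 (.neg (.and (.and (.isPair 1 5 6) (.isPair 2 5 7)) (.neg (.eq 6 7)))))))))))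
  simp only [BoundedFormula.Holds,
    BoundedFormula.holds_isPair hX (show 1 < 10 by omega) (show 5 < 10 by omega)
      (show 6 < 10 by omega),
    BoundedFormula.holds_isPair hX (show 2 < 10 by omega) (show 5 < 10 by omega)
      (show 7 < 10 by omega)] at key
  replace key := (key (assign G G G G)).1
  simp only [assign, ne_eq, zero_ne_one, not_false_eq_true, Function.update_of_ne,
    OfNat.one_ne_ofNat, Function.update_self, Nat.reduceEqDiff, not_and, not_not, and_imp] at key
  refine key ?_ _ hc _ hd _ (upair_mem_pair _ _) _ (upair_mem_pair _ _) _ (left_mem_upair _ _) _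
    (right_mem_upair _ _) _ (right_mem_upair _ _) rfl rfl
  intro p hp p' hp' u _ u' _ q _ c _ d _ hc hd
  obtain rfl : p = pair q c := Superstructure.ext hc
  obtain rfl : p' = pair q d := Superstructure.ext hd
  exact H q c d hp hp'

end IsSingleSuperstructureModel

/-! ### Iterated stars, coherence and the two-step transfer -/

theorem iterStar_add (n m : ℕ) (a : Superstructure X) :
    iterStar star (n + m) a = iterStar star n (iterStar star m a) := by
  induction n with
  | zero => rw [Nat.zero_add]; rfl
  | succ n ih =>
    rw [Nat.succ_add]
    exact congrArg star ih

theorem iterStar_eq_self {a : Superstructure X} (h : star a = a) (k : ℕ) :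
    iterStar star k a = a := by
  induction k with
  | zero => rfl
  | succ k ih => exact (congrArg star ih).trans h

/-- Coherence of `{s}` gives `s ∈ ∗{s}`, and the only element of `∗{s}` is `∗s`. -/
theorem CompletelyCoherent.star_eq_self (h : IsSingleSuperstructureModel X star)
    {S : Superstructure X} {hS : S.IsSet} (hcc : CompletelyCoherent star S hS) (s : Elem S) :
    star s.1 = s.1 := by
  have hs : ofSet S hS {s} = single s.1 := by
    refine Superstructure.ext (ZFSet.ext fun x => ?_)
    refine (ZFSet.mem_sep (p := fun z => ∃ a ∈ ({s} : Set (Elem S)), a.1.1 = z)).trans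
      (Iff.trans ⟨?_, ?_⟩ ZFSet.mem_singleton.symm)
    · rintro ⟨-, a, rfl, rfl⟩
      rfl
    · rintro rfl
      exact ⟨s.2, s, rfl, rfl⟩
  have := hcc {s} s.1 (mem_ofSet.2 ⟨s, rfl, rfl⟩)
  rw [hs] at this
  exact (h.mem_star_single this).symm

theorem exists_memGraph_of_mem_monad (h : IsSingleSuperstructureModel X star)
    {S : Superstructure X} {hS : S.IsSet} [Mul (Elem S)] (hcc : CompletelyCoherent star S hS)
    {𝓤 𝓥 : Ultrafilter (Elem S)} {n m : ℕ} {α β : Superstructure X}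
    (hα : α ∈ monad star hS n 𝓤) (hβ : β ∈ monad star hS m 𝓥) {A : Set (Elem S)}
    (hA : A ∈ odot 𝓤 𝓥) :
    ∃ γ ∈ iterStar star (n + m) (ofSet S hS A),
      MemGraph (iterStar star (n + m) (mulGraph S hS)) α (iterStar star n β) γ := by
  rw [iterStar_add, iterStar_add]
  -- The singleton makes `β` a parameter, which `Sₙ` sends to `Sₙ(β)`.
  refine (h.iterStar n).exists_memGraph (C := single β) ?_ α (hα _ ((mem_odot _ _ _).1 hA))
    _ ((h.iterStar n).mem_iff.1 (mem_single.2 rfl))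
  intro s hs t ht
  obtain rfl := mem_single.1 ht
  obtain ⟨s, hsA, rfl⟩ := mem_ofSet.1 hs
  refine (h.iterStar m).exists_memGraph (B := single s.1) ?_ _ ?_ _ (hβ _ hsA)
  · intro s' hs' t ht
    obtain rfl := mem_single.1 hs'
    obtain ⟨t, htA, rfl⟩ := mem_ofSet.1 ht
    exact ⟨_, mem_ofSet.2 ⟨_, htA, rfl⟩, memGraph_mulGraph s t⟩
  · have := (h.iterStar m).mem_iff.1 (mem_single.2 (rfl : s.1 = s.1))
    rwa [iterStar_eq_self (hcc.star_eq_self h s)] at this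

end IteratedHyper

theorem mainTheorem8 {X : ZFSet.{u}}
    (star : IteratedHyper.Superstructure X → IteratedHyper.Superstructure X)
    (hstar : IteratedHyper.IsSingleSuperstructureModel X star)
    (S : IteratedHyper.Superstructure X) (hS : S.IsSet)
    [Semigroup (IteratedHyper.Elem S)]
    (hcc : IteratedHyper.CompletelyCoherent star S hS)
    (𝓤 𝓥 : Ultrafilter (IteratedHyper.Elem S)) (n m : ℕ)
    (α β : IteratedHyper.Superstructure X)
    (hα : α ∈ IteratedHyper.monad star hS n 𝓤)
    (hβ : β ∈ IteratedHyper.monad star hS m 𝓥) :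
    ∃ γ : IteratedHyper.Superstructure X,
      (∀ δ : IteratedHyper.Superstructure X,
        IteratedHyper.IsHyperProduct star hS (n + m) α (IteratedHyper.iterStar star n β) δ
          ↔ δ = γ) ∧
      γ ∈ IteratedHyper.monad star hS (n + m) (IteratedHyper.odot 𝓤 𝓥) ∧
      γ ∈ IteratedHyper.generators star hS (IteratedHyper.odot 𝓤 𝓥) := by
  -- `Set.univ` belongs to every ultrafilter, so it yields a candidate `γ`; uniqueness then
  -- identifies it with the product found for each `A`.
  obtain ⟨γ, -, hγ⟩ := IteratedHyper.exists_memGraph_of_mem_monad hstar hcc hα hβ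
    (A := Set.univ) Filter.univ_mem
  have huniq (δ : IteratedHyper.Superstructure X) (hδ : IteratedHyper.IsHyperProduct star hS
      (n + m) α (IteratedHyper.iterStar star n β) δ) : δ = γ :=
    (hstar.iterStar (n + m)).eq_of_memGraph
      (fun _ _ _ => IteratedHyper.eq_of_pair_mem_mulGraph) hδ hγ
  have hmon : γ ∈ IteratedHyper.monad star hS (n + m) (IteratedHyper.odot 𝓤 𝓥) := by
    intro A hA
    obtain ⟨δ, hδA, hδ⟩ := IteratedHyper.exists_memGraph_of_mem_monad hstar hcc hα hβ hA
    exact huniq δ hδ ▸ hδA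
  exact ⟨γ, fun δ => ⟨huniq δ, fun h => h ▸ hγ⟩, hmon, fun A hA => ⟨n + m, hmon A hA⟩⟩
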